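/- Let $n\ge 0$ be an integer with $n\neq 2$, and let $\eta=(\eta^{ij})$ be an invertible symmetric complex $n\times n$ matrix with inverse $(\eta_{ij})$. Let $\mathrm{Cl}(\eta)$ be the complex Clifford algebra generated by $\gamma^1,\dots,\gamma^n$ with $\gamma^i\gamma^j+\gamma^j\gamma^i=2\eta^{ij}$. Let $W(2n)$ be the Weyl algebra generated by $x^1,\dots,x^n,\partial_1,\dots,\partial_n$ with $[x^i,x^j]=[\partial_i,\partial_j]=0$ and $[\partial_i,x^j]=\delta_i^j$. Put $W(2n|n)=W(2n)\otimes\mathrm{Cl}(\eta)$. It acts on the space $V=\mathrm{Cl}(\eta)\otimes\mathbb C[x^1,\dots,x^n]$ of Clifford-valued polynomials: $x^i$ and $\gamma^i$ act by left multiplication and $\partial_i$ by differentiation. Let $$V^+=\Big\{\varphi\in V:\ \sum_a\gamma^a\partial_a\varphi=0\Big\}$$ be the space of polynomial solutions of the Dirac equation. Write $x_i=\sum_j\eta_{ij}x^j$, $\partial^i=\sum_j\eta^{ij}\partial_j$, $X=\frac{i}{\sqrt2}\sum_a\gamma^a\partial_a$, $E=-\frac12\sum_a\partial^a\partial_a$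 and $H=-\frac12\sum_a(\partial_ax^a+x^a\partial_a)$. Let $I=W(2n|n)\cdot(\mathbb CX\oplus\mathbb CE)$ be the left ideal generated by $X$ and $E$, let $N=\{a\in W(2n|n): Ia\subseteq I\}$ be its normalizer, and let $Z=N/I$ be the reduction algebra. The action of $N$ on $V$ induces an action of $Z$ on $V^+$. Put $$\widehat{x^i}=(H+1)x^i+\tfrac12\Big(\sum_j\gamma^jx_j\Big)\gamma^i+\tfrac12\Big(\sum_jx^jx_j\Big)\partial^i,\qquad \widetilde{\gamma}^i=\frac{1}{1-\frac n2}\Big((H+1)\gamma^i+\Big(\sum_j\gamma^jx_j\Big)\partial^i\Big).$$ Then the following hold. 1. All $\widehat{x^i}$ and $\widetilde\gamma^i$ lie in $N$, and so define elements of $Z$. 2. Every $\varphi\in V^+$ can be written as a finite sum $$\varphi=\sum_{\alpha,\beta}c_{\alpha,\beta}\,(x^1)^{\alpha_1}\cdots(x^n)^{\alpha_n}\,\gamma^{\beta_1}\cdots\gamma^{\beta_r},\qquad c_{\alpha,\beta}\in\mathbb C,\ \alpha\in\mathbb N^n,$$ in which only strictly increasing words $\beta=(\beta_1<\dots<\beta_r)$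 occur. Moreover, for every finite expansion of $\varphi$ of the displayed form, with arbitrary finite words $\beta$ allowed, the operator $$\widehat\varphi=\sum_{\alpha,\beta}\frac{c_{\alpha,\beta}}{(-1)^{d}\prod_{k=1}^{d}\left(\frac n2+d-k\right)}\,\big(\widehat{x^1}\big)^{\alpha_1}\cdots\big(\widehat{x^n}\big)^{\alpha_n}\,\widetilde\gamma^{\beta_1}\cdots\widetilde\gamma^{\beta_r},\qquad d=\alpha_1+\dots+\alpha_n,$$ lies in $N$, and its class in $Z$ satisfies $\widehat\varphi\cdot 1=\varphi$. 3. Consequently the constant solution $1$ is a cyclic vector of the $Z$-module $V^+$: for every $\varphi\in V^+$ there is $z\in Z$ with $z\cdot1=\varphi$. -/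

import Mathlib

open scoped TensorProduct

noncomputable section

namespace DiracReduction

/-! ### The Weyl algebra, by generators and relations -/

/-- The defining relations of the Weyl algebra; `Sum.inl i` is the generator `x^i`,
`Sum.inr i` is the generator `∂_i`. -/
inductive WeylRel (n : ℕ) : FreeAlgebra ℂ (Fin n ⊕ Fin n) → FreeAlgebra ℂ (Fin n ⊕ Fin n) → Prop
  | xx (i j : Fin n) : WeylRel n
      (FreeAlgebra.ι ℂ (Sum.inl i) * FreeAlgebra.ι ℂ (Sum.inl j))
      (FreeAlgebra.ι ℂ (Sum.inl j) * FreeAlgebra.ι ℂ (Sum.inl i))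
  | dd (i j : Fin n) : WeylRel n
      (FreeAlgebra.ι ℂ (Sum.inr i) * FreeAlgebra.ι ℂ (Sum.inr j))
      (FreeAlgebra.ι ℂ (Sum.inr j) * FreeAlgebra.ι ℂ (Sum.inr i))
  | dx (i j : Fin n) : WeylRel n
      (FreeAlgebra.ι ℂ (Sum.inr i) * FreeAlgebra.ι ℂ (Sum.inl j))
      (FreeAlgebra.ι ℂ (Sum.inl j) * FreeAlgebra.ι ℂ (Sum.inr i) + if i = j then 1 else 0)

/-- The Weyl algebra `W(2n)`. -/
def Weyl (n : ℕ) : Type := RingQuot (WeylRel n)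

instance (n : ℕ) : Ring (Weyl n) := inferInstanceAs (Ring (RingQuot (WeylRel n)))

instance (n : ℕ) : Algebra ℂ (Weyl n) := inferInstanceAs (Algebra ℂ (RingQuot (WeylRel n)))

/-- The quotient map from the free algebra. -/
def Weyl.mk (n : ℕ) : FreeAlgebra ℂ (Fin n ⊕ Fin n) →ₐ[ℂ] Weyl n :=
  RingQuot.mkAlgHom ℂ (WeylRel n)

/-- The generator `x^i` of the Weyl algebra. -/
def Weyl.x {n : ℕ} (i : Fin n) : Weyl n :=
  Weyl.mk n (FreeAlgebra.ι ℂ (Sum.inl i))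

/-- The generator `∂_i` of the Weyl algebra. -/
def Weyl.d {n : ℕ} (i : Fin n) : Weyl n :=
  Weyl.mk n (FreeAlgebra.ι ℂ (Sum.inr i))

theorem Weyl.d_comm {n : ℕ} (i j : Fin n) :
    (Weyl.d i * Weyl.d j : Weyl n) = Weyl.d j * Weyl.d i := by
  have h : Weyl.mk n _ = Weyl.mk n _ := RingQuot.mkAlgHom_rel ℂ (WeylRel.dd i j)
  simpa only [Weyl.d, map_mul] using h

/-- The action of the free algebra on polynomials: `x^i` multiplies, `∂_i` differentiates. -/
def freeAct (n : ℕ) :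
    FreeAlgebra ℂ (Fin n ⊕ Fin n) →ₐ[ℂ] Module.End ℂ (MvPolynomial (Fin n) ℂ) :=
  FreeAlgebra.lift ℂ (Sum.elim
    (fun i => LinearMap.mulLeft ℂ (MvPolynomial.X i))
    (fun i => (MvPolynomial.pderiv i : Derivation ℂ (MvPolynomial (Fin n) ℂ) _).toLinearMap))

theorem freeAct_rel (n : ℕ) ⦃a b : FreeAlgebra ℂ (Fin n ⊕ Fin n)⦄ (h : WeylRel n a b) :
    freeAct n a = freeAct n b := by
  cases h with
  | xx i j =>
    apply LinearMap.ext
    intro p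
    simp [freeAct, mul_left_comm]
  | dd i j =>
    apply LinearMap.ext
    intro p
    let D : Fin n → Derivation ℂ (MvPolynomial (Fin n) ℂ) (MvPolynomial (Fin n) ℂ) :=
      fun i => MvPolynomial.pderiv i
    have h : ⁅D i, D j⁆ = 0 := by
      apply MvPolynomial.derivation_ext
      intro k
      simp only [D, Derivation.commutator_apply, MvPolynomial.pderiv_X, Pi.single_apply]
      split_ifs <;> simp
    have h2 := congrArg (fun D => D p) h
    simp only [D, Derivation.commutator_apply] at h2
    simpa [freeAct] using sub_eq_zero.mp h2
  | dx i j =>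
    apply LinearMap.ext
    intro p
    by_cases hij : i = j
    · subst hij
      simp [freeAct, add_comm]
    · simp [freeAct, hij, MvPolynomial.pderiv_X, Ne.symm hij]

/-- The standard action of the Weyl algebra on polynomials. -/
def weylAct (n : ℕ) : Weyl n →ₐ[ℂ] Module.End ℂ (MvPolynomial (Fin n) ℂ) :=
  RingQuot.liftAlgHom ℂ ⟨freeAct n, freeAct_rel n⟩

theorem weylAct_mk (n : ℕ) (a : FreeAlgebra ℂ (Fin n ⊕ Fin n)) :
    weylAct n (Weyl.mk n a) = freeAct n a :=
  RingQuot.liftAlgHom_mkAlgHom_apply ℂ _ (freeAct_rel n) a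

theorem weylAct_d {n : ℕ} (i : Fin n) (p : MvPolynomial (Fin n) ℂ) :
    weylAct n (Weyl.d i) p = MvPolynomial.pderiv i p := by
  rw [Weyl.d, weylAct_mk]; simp [freeAct]

/-! ### The Clifford algebra and the Weyl-Clifford algebra -/

variable {n : ℕ} (η : Matrix (Fin n) (Fin n) ℂ)

/-- The Clifford algebra of the quadratic form `v ↦ ∑ η^{ij} v_i v_j`. -/
abbrev Cl : Type := CliffordAlgebra (Matrix.toQuadraticForm' η)

/-- The generator `γ^i` of the Clifford algebra. -/
def clGamma (i : Fin n) : Cl η := CliffordAlgebra.ι (Matrix.toQuadraticForm' η) (Pi.single i 1)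

theorem clGamma_anticomm (i j : Fin n) :
    clGamma η i * clGamma η j + clGamma η j * clGamma η i =
      algebraMap ℂ (Cl η) (η i j + η j i) := by
  unfold clGamma
  rw [CliffordAlgebra.ι_mul_ι_add_swap]
  congr 1
  simp [Matrix.toQuadraticForm', LinearMap.BilinMap.polar_toQuadraticMap,
    Matrix.toLinearMap₂'_apply']

/-- The Weyl-Clifford algebra `W(2n|n) = W(2n) ⊗ Cl(η)`. -/
abbrev WC : Type := Weyl n ⊗[ℂ] Cl η

/-- The element `x^i`. -/
def x (i : Fin n) : WC η := Weyl.x i ⊗ₜ 1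
/-- The element `∂_i`. -/
def d (i : Fin n) : WC η := Weyl.d i ⊗ₜ 1
/-- The element `γ^i`. -/
def γ (i : Fin n) : WC η := 1 ⊗ₜ clGamma η i

/-- `x_i = ∑ η_{ij} x^j`, where `(η_{ij})` is the inverse matrix of `(η^{ij})`. -/
def xLow (i : Fin n) : WC η := ∑ j, η⁻¹ i j • x η j
/-- `∂^i = ∑ η^{ij} ∂_j`. -/
def dUp (i : Fin n) : WC η := ∑ j, η i j • d η j

/-- `X = (i/√2) ∑ γ^a ∂_a`, a multiple of the Dirac operator. -/
def opX : WC η := (Complex.I / (Real.sqrt 2 : ℂ)) • ∑ a, γ η a * d η a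
/-- `E = -(1/2) ∑ ∂^a ∂_a`. -/
def opE : WC η := (-(1 / 2) : ℂ) • ∑ a, dUp η a * d η a
/-- `H = -(1/2) ∑ (∂_a x^a + x^a ∂_a)`. -/
def opH : WC η := (-(1 / 2) : ℂ) • ∑ a, (d η a * x η a + x η a * d η a)

theorem opX_mul_opX : opX η * opX η = opE η := by
  have hc : (Complex.I / (Real.sqrt 2 : ℂ)) * (Complex.I / (Real.sqrt 2 : ℂ)) = -(1 / 2) := by
    have h2 : (Real.sqrt 2 : ℂ) * (Real.sqrt 2 : ℂ) = 2 := by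
      rw [← Complex.ofReal_mul, Real.mul_self_sqrt (by norm_num)]; norm_num
    rw [div_mul_div_comm, Complex.I_mul_I, h2]; norm_num
  have hgd : ∀ a b : Fin n, (γ η a * d η a) * (γ η b * d η b) =
      (Weyl.d a * Weyl.d b) ⊗ₜ[ℂ] (clGamma η a * clGamma η b) := by
    intro a b
    simp [γ, d, Algebra.TensorProduct.tmul_mul_tmul]
  set S : WC η := ∑ a, ∑ b, (Weyl.d a * Weyl.d b) ⊗ₜ[ℂ] (clGamma η a * clGamma η b) with hS
  set T : WC η := ∑ a, dUp η a * d η a with hT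
  have hT' : T = ∑ a, ∑ b, η a b • ((Weyl.d a * Weyl.d b) ⊗ₜ[ℂ] (1 : Cl η)) := by
    rw [hT]
    refine Finset.sum_congr rfl fun a _ => ?_
    rw [dUp, Finset.sum_mul]
    refine Finset.sum_congr rfl fun b _ => ?_
    rw [d, d, smul_mul_assoc, Algebra.TensorProduct.tmul_mul_tmul, Weyl.d_comm a b, one_mul]
  have hswap : S = ∑ a, ∑ b, (Weyl.d a * Weyl.d b) ⊗ₜ[ℂ] (clGamma η b * clGamma η a) := by
    rw [hS, Finset.sum_comm]
    refine Finset.sum_congr rfl fun a _ => Finset.sum_congr rfl fun b _ => ?_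
    rw [Weyl.d_comm]
  have hTs : T = ∑ a, ∑ b, η b a • ((Weyl.d a * Weyl.d b) ⊗ₜ[ℂ] (1 : Cl η)) := by
    rw [hT', Finset.sum_comm]
    refine Finset.sum_congr rfl fun a _ => Finset.sum_congr rfl fun b _ => ?_
    rw [Weyl.d_comm]
  have h2 : S + S = T + T := by
    nth_rewrite 2 [hswap]
    nth_rewrite 2 [hTs]
    rw [hS, hT', ← Finset.sum_add_distrib, ← Finset.sum_add_distrib]
    refine Finset.sum_congr rfl fun a _ => ?_
    rw [← Finset.sum_add_distrib, ← Finset.sum_add_distrib]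
    refine Finset.sum_congr rfl fun b _ => ?_
    rw [← TensorProduct.tmul_add, clGamma_anticomm, ← add_smul, Algebra.algebraMap_eq_smul_one,
      TensorProduct.tmul_smul]
  have hST : S = T := by
    rw [← two_smul ℂ S, ← two_smul ℂ T] at h2
    exact smul_right_injective _ (two_ne_zero' ℂ) h2
  rw [opX, opE, smul_mul_smul_comm, hc, Finset.sum_mul_sum, ← hT, ← hST, hS]
  simp only [hgd]

/-- `𝔤₊ = ℂ X ⊕ ℂ E`. -/
def gPlus : Submodule ℂ (WC η) := Submodule.span ℂ {opX η, opE η}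

/-- The left ideal `I = W(2n|n) 𝔤₊` (`Ideal` means left ideal over a noncommutative ring). -/
def idealI : Ideal (WC η) := Ideal.span (gPlus η : Set (WC η))

theorem mem_idealI {a : WC η} (ha : a ∈ idealI η) : ∃ b, a = b * opX η := by
  have h : idealI η ≤ Ideal.span {opX η} := by
    refine Ideal.span_le.mpr fun g hg => ?_
    obtain ⟨s, t, rfl⟩ := Submodule.mem_span_pair.mp hg
    refine Ideal.mem_span_singleton'.mpr
      ⟨algebraMap ℂ _ s + algebraMap ℂ _ t * opX η, ?_⟩
    rw [add_mul, mul_assoc, opX_mul_opX, ← Algebra.smul_def, ← Algebra.smul_def]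
  obtain ⟨b, hb⟩ := Ideal.mem_span_singleton'.mp (h ha)
  exact ⟨b, hb.symm⟩

theorem opX_mem_idealI : opX η ∈ idealI η :=
  Ideal.subset_span (Submodule.subset_span (by simp))

/-! ### The reduction algebra -/

/-- The normalizer `N = {a | I a ⊆ I}` of the left ideal `I`. -/
def normalizerN : Subalgebra ℂ (WC η) where
  carrier := {a | ∀ b ∈ idealI η, b * a ∈ idealI η}
  mul_mem' := by
    intro a a' ha ha' b hb
    rw [← mul_assoc]
    exact ha' _ (ha b hb)
  add_mem' := by
    intro a a' ha ha' b hb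
    rw [mul_add]
    exact (idealI η).add_mem (ha b hb) (ha' b hb)
  algebraMap_mem' := by
    intro r b hb
    rw [← Algebra.commutes]
    exact (idealI η).mul_mem_left _ hb

/-- `I` as an ideal of its normalizer. -/
def idealN : Ideal (normalizerN η) := (idealI η).comap (normalizerN η).val

instance : (idealN η).IsTwoSided where
  mul_mem_of_left := by
    intro a b ha
    exact b.2 _ ha

/-- The reduction algebra `Z = N / I`. -/
abbrev Z : Type := normalizerN η ⧸ idealN η

/-- The class in `Z` of an element of the normalizer. -/
def toZ (a : WC η) (ha : a ∈ normalizerN η) : Z η := Ideal.Quotient.mk (idealN η) ⟨a, ha⟩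

/-! ### Clifford-valued polynomials and solutions of the Dirac equation -/

/-- The space of Clifford-valued polynomials `Cl(η) ⊗ ℂ[x^1, …, x^n]`. -/
abbrev V : Type := Cl η ⊗[ℂ] MvPolynomial (Fin n) ℂ

/-- The action of the Weyl-Clifford algebra on Clifford-valued polynomials: `x^i` and `∂_i` act on
the polynomial factor, `γ^i` acts by left multiplication on the Clifford factor. -/
def act : WC η →ₐ[ℂ] Module.End ℂ (V η) :=
  ((Module.endTensorEndAlgHom (R := ℂ) (A := ℂ) (M := Cl η) (N := MvPolynomial (Fin n) ℂ)).comp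
    (Algebra.TensorProduct.map (Algebra.lmul ℂ (Cl η)) (weylAct n))).comp
    (Algebra.TensorProduct.comm ℂ (Weyl n) (Cl η)).toAlgHom

theorem act_tmul (w : Weyl n) (c q : Cl η) (p : MvPolynomial (Fin n) ℂ) :
    act η (w ⊗ₜ c) (q ⊗ₜ p) = (c * q) ⊗ₜ weylAct n w p := by
  simp only [act, AlgHom.comp_apply, AlgEquiv.toAlgHom_apply, Algebra.TensorProduct.comm_tmul,
    Algebra.TensorProduct.map_tmul]
  rfl

/-- The solution space `V⁺` of the Dirac equation `∑ γ^a ∂_a φ = 0`. -/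
def Vplus : Submodule ℂ (V η) := LinearMap.ker (act η (∑ a, γ η a * d η a))

theorem opX_act {φ : V η} (hφ : φ ∈ Vplus η) : act η (opX η) φ = 0 := by
  rw [Vplus, LinearMap.mem_ker] at hφ
  rw [opX, map_smul, LinearMap.smul_apply, hφ, smul_zero]

theorem idealI_act {a : WC η} (ha : a ∈ idealI η) {φ : V η} (hφ : φ ∈ Vplus η) :
    act η a φ = 0 := by
  obtain ⟨b, rfl⟩ := mem_idealI η ha
  rw [map_mul, Module.End.mul_apply, opX_act η hφ, map_zero]

theorem mem_Vplus_of_opX {φ : V η} (hφ : act η (opX η) φ = 0) : φ ∈ Vplus η := by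
  rw [opX, map_smul, LinearMap.smul_apply] at hφ
  rw [Vplus, LinearMap.mem_ker]
  refine (smul_eq_zero.mp hφ).resolve_left ?_
  simp

theorem normalizerN_act (a : normalizerN η) {φ : V η} (hφ : φ ∈ Vplus η) :
    act η a φ ∈ Vplus η := by
  apply mem_Vplus_of_opX
  rw [← Module.End.mul_apply, ← map_mul]
  exact idealI_act η (a.2 _ (opX_mem_idealI η)) hφ

/-- The action of the normalizer on `V⁺`. -/
def actN : normalizerN η →ₐ[ℂ] Module.End ℂ (Vplus η) where
  toFun a := (act η a).restrict fun _ hφ => normalizerN_act η a hφ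
  map_one' := by ext φ; simp
  map_mul' a b := by ext φ; simp
  map_zero' := by ext φ; simp
  map_add' a b := by ext φ; simp
  commutes' r := by
    ext φ
    change act η (algebraMap ℂ (WC η) r) φ = r • (φ : V η)
    rw [AlgHom.commutes, Module.algebraMap_end_apply]

/-- The action of the reduction algebra on `V⁺`, induced by the action on `V`. -/
def actZ : Z η →ₐ[ℂ] Module.End ℂ (Vplus η) :=
  Ideal.Quotient.liftₐ (idealN η) (actN η) fun a ha => by
    ext φ
    exact idealI_act η ha φ.2

/-- The constant solution `1`. -/
def oneSol : Vplus η := ⟨1 ⊗ₜ 1, by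
  rw [Vplus, LinearMap.mem_ker, map_sum, LinearMap.sum_apply]
  refine Finset.sum_eq_zero fun a _ => ?_
  rw [γ, d, Algebra.TensorProduct.tmul_mul_tmul, act_tmul, one_mul, weylAct_d, MvPolynomial.pderiv_one,
    TensorProduct.tmul_zero]⟩

/-! ### The operators -/

/-- The raising operator
`(H+1) x^i + (1/2) (∑ γ^j x_j) γ^i + (1/2) (∑ x^j x_j) ∂^i`. -/
def xHat (i : Fin n) : WC η :=
  (opH η + 1) * x η i + (1 / 2 : ℂ) • ((∑ j, γ η j * xLow η j) * γ η i)
    + (1 / 2 : ℂ) • ((∑ j, x η j * xLow η j) * dUp η i)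

/-- The operator `(H+1) γ^i + (∑ γ^j x_j) ∂^i`. -/
def gammaHat (i : Fin n) : WC η :=
  (opH η + 1) * γ η i + (∑ j, γ η j * xLow η j) * dUp η i

/-- The normalized Clifford operator `(1 - n/2)⁻¹ ((H+1) γ^i + (∑ γ^j x_j) ∂^i)`. -/
def gammaTilde (i : Fin n) : WC η := (1 - (n : ℂ) / 2)⁻¹ • gammaHat η i

/-- The ordered product of the raising operators with exponents `α`: the operator of index `i`
occurs `α i` times, in order of increasing index. -/
def xHatMon (α : Fin n →₀ ℕ) : WC η := (List.ofFn fun i => xHat η i ^ α i).prod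

/-- The normalizing scalar `(-1)^d ∏_{k=1}^d (n/2 + d - k)`. -/
def normConst (n d : ℕ) : ℂ := (-1) ^ d * ∏ k ∈ Finset.Icc 1 d, ((n : ℂ) / 2 + (d : ℂ) - (k : ℂ))

/-- Coefficients `c_{α, β}` of an expansion into monomials `x^α γ^{β_1} ⋯ γ^{β_r}`. -/
abbrev Coeffs (n : ℕ) : Type := (Fin n →₀ ℕ) × List (Fin n) →₀ ℂ

/-- The Clifford-valued polynomial `∑ c_{α, β} x^α γ^{β_1} ⋯ γ^{β_r}`. -/
def expand (c : Coeffs n) : V η :=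
  c.sum fun w a => a • ((w.2.map (clGamma η)).prod ⊗ₜ MvPolynomial.monomial w.1 1)

/-- The operator obtained from an expansion: `x^α` is replaced by the normalized ordered product of
raising operators and each `γ^i` by the normalized Clifford operator. -/
def hatOp (c : Coeffs n) : WC η :=
  c.sum fun w a => (a / normConst n w.1.degree) •
    (xHatMon η w.1 * (w.2.map (gammaTilde η)).prod)

end DiracReduction

end

/-!
Write `D = ∑ γ^a ∂_a` for the Dirac operator and `Θ = ∑ γ^j x_j` for the Clifford variable. In the
Weyl-Clifford algebra they satisfy the relations of `osp(1|2)`: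
`D Θ + Θ D = -2H` (`dirac_mul_cliffVar`), `[H, D] = D`, `[H, Θ] = -Θ`, and `Θ² = ∑ x^j x_j`.

As `E = X²`, the left ideal `I` is generated by `D`, so an element `a` lies in the normalizer as soon
as `D a` is a left multiple of `D` (`mem_normalizerN_of_dirac_mul`). This is checked by moving `D` to
the right through the operators `x̂^i` and `γ̃^i` (`dirac_mul_xHat`, `dirac_mul_gammaHat`).

For the action, the point is that the operators are computed modulo `Θ V`. The last two terms of
`x̂^i` are left multiples of `Θ`, and the first one, `(H + 1) x^i`, preserves `Θ V` and acts on
polynomials of degree `k` as `-(k + n/2) x^i`. A word of length `d` in the `x̂^i`, applied to a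
constant, is therefore congruent to the corresponding monomial times
`(-1)^d ∏_{k=1}^d (n/2 + d - k)` (`act_prod_xHat_sub_mem_cliffRange`), while `γ̃^i` acts on constants
as `γ^i`; here `n ≠ 2` is what makes the normalization of `γ̃^i` meaningful. So `φ̂ · 1` is congruent
to `φ` modulo `Θ V` for every expansion of `φ`. Both are solutions of the Dirac equation, and
`V⁺ ∩ Θ V = 0` (`disjoint_Vplus_cliffRange`), the directness of the Fischer decomposition. The last fact
is proved algebraically, as `η` is complex and there is no positive definite inner product at hand:
on degree `k`, `Θ D Θ^m = c Θ^m ± Θ^{m+1} D` with `c ≠ 0`, which allows an induction on `k`.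

Increasing words suffice in an expansion since they span the Clifford algebra (`wordSpan_univ`).
-/

noncomputable section

namespace DiracReduction

variable {n : ℕ} (η : Matrix (Fin n) (Fin n) ℂ)

/-! ### Relations between the generators -/

theorem x_mul_x (i j : Fin n) : x η i * x η j = x η j * x η i := by
  have h : Weyl.mk n _ = Weyl.mk n _ := RingQuot.mkAlgHom_rel ℂ (WeylRel.xx i j)
  have h' : (Weyl.x i * Weyl.x j : Weyl n) = Weyl.x j * Weyl.x i := by
    simpa only [Weyl.x, map_mul] using h
  simp only [x, Algebra.TensorProduct.tmul_mul_tmul, h']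

theorem d_mul_d (i j : Fin n) : d η i * d η j = d η j * d η i := by
  simp only [d, Algebra.TensorProduct.tmul_mul_tmul, Weyl.d_comm i j]

theorem d_mul_x (i j : Fin n) :
    d η i * x η j = x η j * d η i + (if i = j then (1 : ℂ) else 0) • 1 := by
  have h : Weyl.mk n _ = Weyl.mk n _ := RingQuot.mkAlgHom_rel ℂ (WeylRel.dx i j)
  have h' : (Weyl.d i * Weyl.x j : Weyl n) =
      Weyl.x j * Weyl.d i + (if i = j then (1 : ℂ) else 0) • 1 := by
    rw [map_mul, map_add, map_mul] at h
    rw [Weyl.d, Weyl.x, h]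
    split_ifs <;> simp
  simp only [x, d, Algebra.TensorProduct.tmul_mul_tmul, h', TensorProduct.add_tmul, mul_one]
  rw [← TensorProduct.smul_tmul', Algebra.TensorProduct.one_def]

theorem x_mul_γ (i j : Fin n) : x η i * γ η j = γ η j * x η i := by
  simp [x, γ, Algebra.TensorProduct.tmul_mul_tmul]

theorem d_mul_γ (i j : Fin n) : d η i * γ η j = γ η j * d η i := by
  simp [d, γ, Algebra.TensorProduct.tmul_mul_tmul]

variable {η}

theorem γ_anticomm (hη : η.IsSymm) (i j : Fin n) :
    γ η i * γ η j + γ η j * γ η i = (2 * η i j) • (1 : WC η) := by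
  simp only [γ, Algebra.TensorProduct.tmul_mul_tmul, mul_one]
  rw [← TensorProduct.tmul_add, clGamma_anticomm, hη.apply i j, ← two_mul,
    Algebra.algebraMap_eq_smul_one, TensorProduct.tmul_smul, Algebra.TensorProduct.one_def]

variable (η)

theorem xLow_mul_γ (i j : Fin n) : xLow η i * γ η j = γ η j * xLow η i := by
  simp only [xLow, Finset.sum_mul, Finset.mul_sum, smul_mul_assoc, mul_smul_comm, x_mul_γ]

theorem xLow_mul_x (i j : Fin n) : xLow η i * x η j = x η j * xLow η i := by
  simp only [xLow, Finset.sum_mul, Finset.mul_sum, smul_mul_assoc, mul_smul_comm, x_mul_x η _ j]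

theorem xLow_mul_xLow (i j : Fin n) : xLow η i * xLow η j = xLow η j * xLow η i := by
  rw [xLow.eq_1 η j]
  simp only [Finset.sum_mul, Finset.mul_sum, smul_mul_assoc, mul_smul_comm, xLow_mul_x]

theorem d_mul_xLow (i j : Fin n) :
    d η i * xLow η j = xLow η j * d η i + η⁻¹ j i • 1 := by
  simp [xLow, Finset.sum_mul, Finset.mul_sum, d_mul_x, smul_add, Finset.sum_add_distrib]

variable {η}

theorem sum_smul_xLow (hdet : IsUnit η.det) (i : Fin n) : ∑ j, η i j • xLow η j = x η i := by
  simp only [xLow, Finset.smul_sum, smul_smul]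
  rw [Finset.sum_comm]
  simp only [← Finset.sum_smul]
  have h : ∀ k, ∑ j, η i j * η⁻¹ j k = if i = k then 1 else 0 := fun k => by
    rw [← Matrix.mul_apply, Matrix.mul_nonsing_inv _ hdet, Matrix.one_apply]
  simp [h]

variable (η)

/-- The Dirac operator `D = ∑ γ^a ∂_a`. -/
def dirac : WC η := ∑ a, γ η a * d η a

/-- The Clifford variable `Θ = ∑ γ^j x_j`. -/
def cliffVar : WC η := ∑ j, γ η j * xLow η j

theorem opX_eq : opX η = (Complex.I / (Real.sqrt 2 : ℂ)) • dirac η := rfl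

theorem opH_eq : opH η = -(∑ a, x η a * d η a) - ((n : ℂ) / 2) • 1 := by
  simp only [opH, d_mul_x, if_true, one_smul]
  have h : ∀ a : Fin n, x η a * d η a + 1 + x η a * d η a = (2 : ℂ) • (x η a * d η a) + 1 :=
    fun a => by rw [two_smul]; abel
  simp only [h, Finset.sum_add_distrib, ← Finset.smul_sum, smul_add, smul_smul]
  simp only [Finset.sum_const, Finset.card_univ, Fintype.card_fin, ← Nat.cast_smul_eq_nsmul ℂ,
    smul_smul]
  module

theorem opH_mul_x (i : Fin n) : opH η * x η i = x η i * opH η - x η i := by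
  have h : ∀ a : Fin n, x η a * d η a * x η i =
      x η i * (x η a * d η a) + (if a = i then (1 : ℂ) else 0) • x η a := fun a => by
    rw [mul_assoc, d_mul_x, mul_add, ← mul_assoc, x_mul_x, mul_assoc, mul_smul_comm, mul_one]
  rw [opH_eq, sub_mul, neg_mul, Finset.sum_mul]
  simp only [h, Finset.sum_add_distrib, mul_sub, mul_neg, Finset.mul_sum, smul_mul_assoc,
    mul_smul_comm, one_mul, mul_one, ite_smul, one_smul, zero_smul, Finset.sum_ite_eq',
    Finset.mem_univ, if_true]
  abel

theorem opH_mul_d (i : Fin n) : opH η * d η i = d η i * opH η + d η i := by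
  have h : ∀ a : Fin n, d η i * (x η a * d η a) =
      x η a * d η a * d η i + (if i = a then (1 : ℂ) else 0) • d η a := fun a => by
    rw [← mul_assoc, d_mul_x, add_mul, mul_assoc, d_mul_d, ← mul_assoc, smul_mul_assoc, one_mul]
  rw [opH_eq, mul_sub, mul_neg, Finset.mul_sum]
  simp only [h, Finset.sum_add_distrib, sub_mul, neg_mul, Finset.sum_mul, smul_mul_assoc,
    mul_smul_comm, one_mul, mul_one, ite_smul, one_smul, zero_smul, Finset.sum_ite_eq,
    Finset.mem_univ, if_true]
  abel

theorem opH_mul_γ (i : Fin n) : opH η * γ η i = γ η i * opH η := by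
  have h : ∀ a : Fin n, x η a * d η a * γ η i = γ η i * (x η a * d η a) := fun a => by
    rw [mul_assoc, d_mul_γ, ← mul_assoc, x_mul_γ, mul_assoc]
  rw [opH_eq, sub_mul, neg_mul, Finset.sum_mul]
  simp only [h, mul_sub, mul_neg, Finset.mul_sum, smul_mul_assoc, mul_smul_comm, one_mul, mul_one]

theorem opH_mul_cliffVar : opH η * cliffVar η = cliffVar η * opH η - cliffVar η := by
  have h : ∀ j, opH η * xLow η j = xLow η j * opH η - xLow η j := fun j => by
    simp only [xLow, Finset.mul_sum, Finset.sum_mul, mul_smul_comm, smul_mul_assoc, opH_mul_x,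
      smul_sub, Finset.sum_sub_distrib]
  have h' : ∀ j, opH η * (γ η j * xLow η j) =
      γ η j * xLow η j * opH η - γ η j * xLow η j := fun j => by
    rw [← mul_assoc, opH_mul_γ, mul_assoc, h, mul_sub, ← mul_assoc]
  simp only [cliffVar, Finset.mul_sum, Finset.sum_mul, h', Finset.sum_sub_distrib]

theorem opH_mul_dirac : opH η * dirac η = dirac η * opH η + dirac η := by
  have h' : ∀ j, opH η * (γ η j * d η j) =
      γ η j * d η j * opH η + γ η j * d η j := fun j => by
    rw [← mul_assoc, opH_mul_γ, mul_assoc, opH_mul_d, mul_add, ← mul_assoc]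
  simp only [dirac, Finset.mul_sum, Finset.sum_mul, h', Finset.sum_add_distrib]

theorem dirac_mul_x (i : Fin n) : dirac η * x η i = x η i * dirac η + γ η i := by
  have h : ∀ a : Fin n, γ η a * d η a * x η i =
      x η i * (γ η a * d η a) + (if a = i then (1 : ℂ) else 0) • γ η a := fun a => by
    rw [mul_assoc, d_mul_x, mul_add, ← mul_assoc, ← x_mul_γ, mul_assoc, mul_smul_comm, mul_one]
  simp only [dirac, Finset.mul_sum, Finset.sum_mul, h, Finset.sum_add_distrib, ite_smul, one_smul,
    zero_smul, Finset.sum_ite_eq', Finset.mem_univ, if_true]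

theorem dirac_mul_dUp (i : Fin n) : dirac η * dUp η i = dUp η i * dirac η := by
  have h : ∀ a j : Fin n, γ η a * d η a * d η j = d η j * (γ η a * d η a) := fun a j => by
    rw [mul_assoc, d_mul_d, ← mul_assoc, ← d_mul_γ, mul_assoc]
  simp only [dirac, dUp, Finset.mul_sum, Finset.sum_mul, mul_smul_comm, smul_mul_assoc, h,
    Finset.smul_sum]
  exact Finset.sum_comm

theorem cliffVar_mul_x (i : Fin n) : cliffVar η * x η i = x η i * cliffVar η := by
  have h : ∀ a : Fin n, γ η a * xLow η a * x η i = x η i * (γ η a * xLow η a) := fun a => by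
    rw [mul_assoc, xLow_mul_x, ← mul_assoc, ← x_mul_γ, mul_assoc]
  simp only [cliffVar, Finset.mul_sum, Finset.sum_mul, h]

variable {η}

theorem dirac_mul_γ (hη : η.IsSymm) (i : Fin n) :
    dirac η * γ η i = (2 : ℂ) • dUp η i - γ η i * dirac η := by
  have h : ∀ a : Fin n, γ η a * d η a * γ η i =
      (2 : ℂ) • η i a • d η a - γ η i * (γ η a * d η a) := fun a => by
    rw [mul_assoc, d_mul_γ, ← mul_assoc, eq_sub_of_add_eq (γ_anticomm hη a i), sub_mul,
      smul_mul_assoc, one_mul, mul_assoc, hη.apply, smul_smul]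
  simp only [dirac, dUp, Finset.mul_sum, Finset.sum_mul, h, Finset.sum_sub_distrib,
    Finset.smul_sum]

/-- A symmetric array of coefficients only sees the anticommutators of the `γ^i`. -/
theorem two_smul_sum_γ_mul_γ (hη : η.IsSymm) (T : Fin n → Fin n → WC η)
    (hT : ∀ i j, T i j = T j i) :
    (2 : ℂ) • ∑ i, ∑ j, γ η i * γ η j * T i j = (2 : ℂ) • ∑ i, ∑ j, η i j • T i j := by
  have hswap : ∑ i, ∑ j, γ η i * γ η j * T i j = ∑ i, ∑ j, γ η j * γ η i * T i j := by
    rw [Finset.sum_comm]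
    exact Finset.sum_congr rfl fun j _ => Finset.sum_congr rfl fun i _ => by rw [hT]
  rw [two_smul]
  nth_rewrite 2 [hswap]
  simp only [← Finset.sum_add_distrib, ← add_mul, γ_anticomm hη, smul_mul_assoc, one_mul,
    Finset.smul_sum, smul_smul]

theorem sum_γ_mul_γ (hη : η.IsSymm) (T : Fin n → Fin n → WC η) (hT : ∀ i j, T i j = T j i) :
    ∑ i, ∑ j, γ η i * γ η j * T i j = ∑ i, ∑ j, η i j • T i j :=
  smul_right_injective _ (two_ne_zero' ℂ) (two_smul_sum_γ_mul_γ hη T hT)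

theorem cliffVar_mul_cliffVar (hη : η.IsSymm) (hdet : IsUnit η.det) :
    cliffVar η * cliffVar η = ∑ j, x η j * xLow η j := by
  have h : ∀ i j, γ η i * xLow η i * (γ η j * xLow η j) =
      γ η i * γ η j * (xLow η i * xLow η j) := fun i j => by
    rw [mul_assoc, ← mul_assoc (xLow η i), xLow_mul_γ, mul_assoc, mul_assoc]
  rw [cliffVar, Finset.sum_mul_sum]
  simp only [h]
  rw [sum_γ_mul_γ hη _ fun i j => xLow_mul_xLow η i j]
  refine Finset.sum_congr rfl fun i _ => ?_
  simp only [← mul_smul_comm]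
  rw [← Finset.mul_sum, sum_smul_xLow hdet, xLow_mul_x]

theorem dirac_mul_cliffVar (hη : η.IsSymm) (hdet : IsUnit η.det) :
    dirac η * cliffVar η = (-2 : ℂ) • opH η - cliffVar η * dirac η := by
  have h1 : ∀ i j, γ η i * d η i * (γ η j * xLow η j) =
      γ η i * γ η j * (η⁻¹ j i • 1) + γ η i * γ η j * (xLow η j * d η i) := fun i j => by
    rw [mul_assoc, ← mul_assoc (d η i), d_mul_γ, mul_assoc, d_mul_xLow, ← mul_assoc, mul_add,
      add_comm]
  have h2 : ∀ i j, γ η j * xLow η j * (γ η i * d η i) =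
      γ η j * γ η i * (xLow η j * d η i) := fun i j => by
    rw [mul_assoc, ← mul_assoc (xLow η j), xLow_mul_γ, mul_assoc, mul_assoc]
  have hinv : η⁻¹.IsSymm := by
    rw [Matrix.IsSymm, Matrix.transpose_nonsing_inv, hη.eq]
  -- the contraction `∑ η^{ij} η_{ji} = n`
  have htr : ∑ i, ∑ j, γ η i * γ η j * (η⁻¹ j i • (1 : WC η)) = (n : ℂ) • 1 := by
    rw [sum_γ_mul_γ hη _ fun i j => by rw [hinv.apply]]
    simp only [smul_smul, ← Finset.sum_smul]
    congr 1
    have h : ∀ i, ∑ j, η i j * η⁻¹ j i = 1 := fun i => by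
      rw [← Matrix.mul_apply, Matrix.mul_nonsing_inv _ hdet, Matrix.one_apply_eq]
    simp [h]
  have hsum : ∑ i, ∑ j, γ η i * γ η j * (xLow η j * d η i) +
      ∑ i, ∑ j, γ η j * γ η i * (xLow η j * d η i) = (2 : ℂ) • ∑ i, x η i * d η i := by
    simp only [← Finset.sum_add_distrib, ← add_mul, γ_anticomm hη, smul_mul_assoc, one_mul,
      mul_smul]
    simp only [← Finset.smul_sum]
    congr 1
    refine Finset.sum_congr rfl fun i _ => ?_
    simp only [← smul_mul_assoc]
    rw [← Finset.sum_mul, sum_smul_xLow hdet]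
  have hA : dirac η * cliffVar η = (n : ℂ) • 1 +
      ∑ i, ∑ j, γ η i * γ η j * (xLow η j * d η i) := by
    rw [dirac, cliffVar, Finset.sum_mul_sum]
    simp only [h1, Finset.sum_add_distrib]
    rw [htr]
  have hB : cliffVar η * dirac η = ∑ i, ∑ j, γ η j * γ η i * (xLow η j * d η i) := by
    rw [dirac, cliffVar, Finset.sum_mul_sum, Finset.sum_comm]
    simp only [h2]
  rw [eq_sub_iff_add_eq, hA, hB, add_assoc, hsum, opH_eq]
  module

theorem xHat_eq (hη : η.IsSymm) (hdet : IsUnit η.det) (i : Fin n) :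
    xHat η i = (opH η + 1) * x η i + (1 / 2 : ℂ) • (cliffVar η * γ η i)
      + (1 / 2 : ℂ) • (cliffVar η * cliffVar η * dUp η i) := by
  rw [cliffVar_mul_cliffVar hη hdet, xHat, cliffVar]

theorem gammaHat_eq (i : Fin n) :
    gammaHat η i = (opH η + 1) * γ η i + cliffVar η * dUp η i := rfl

/-! ### The normalizer -/

theorem dirac_mem_idealI : dirac η ∈ idealI η := by
  have h : dirac η = (Complex.I / (Real.sqrt 2 : ℂ))⁻¹ • opX η := by
    rw [opX_eq, inv_smul_smul₀]
    simp
  rw [h, Algebra.smul_def]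
  exact (idealI η).mul_mem_left _ (opX_mem_idealI η)

/-- As `E = X²`, the left ideal `I` is generated by the Dirac operator `D`, and `a` normalizes it as
soon as `D a` is a left multiple of `D`. -/
theorem mem_normalizerN_of_dirac_mul {a b : WC η} (h : dirac η * a = b * dirac η) :
    a ∈ normalizerN η := by
  intro c hc
  obtain ⟨e, rfl⟩ := mem_idealI η hc
  rw [opX_eq, mul_smul_comm, smul_mul_assoc, mul_assoc, h, ← mul_assoc, ← smul_mul_assoc]
  exact (idealI η).mul_mem_left _ dirac_mem_idealI

theorem dirac_mul_opH_add_one : dirac η * (opH η + 1) = opH η * dirac η := by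
  rw [mul_add, mul_one, opH_mul_dirac]

theorem dirac_mul_gammaHat (hη : η.IsSymm) (hdet : IsUnit η.det) (i : Fin n) :
    dirac η * gammaHat η i = -(opH η * γ η i + cliffVar η * dUp η i) * dirac η := by
  have h1 : dirac η * ((opH η + 1) * γ η i) =
      (2 : ℂ) • (opH η * dUp η i) - opH η * γ η i * dirac η := by
    rw [← mul_assoc, dirac_mul_opH_add_one, mul_assoc, dirac_mul_γ hη, mul_sub, mul_smul_comm,
      ← mul_assoc]
  have h2 : dirac η * (cliffVar η * dUp η i) =
      (-2 : ℂ) • (opH η * dUp η i) - cliffVar η * dUp η i * dirac η := by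
    rw [← mul_assoc, dirac_mul_cliffVar hη hdet, sub_mul, smul_mul_assoc, mul_assoc (cliffVar η),
      dirac_mul_dUp, ← mul_assoc]
  rw [gammaHat_eq, mul_add, h1, h2, neg_mul, add_mul]
  module

theorem gammaTilde_mem_normalizerN (hη : η.IsSymm) (hdet : IsUnit η.det) (i : Fin n) :
    gammaTilde η i ∈ normalizerN η :=
  (normalizerN η).smul_mem (mem_normalizerN_of_dirac_mul (dirac_mul_gammaHat hη hdet i)) _

theorem dirac_mul_cliffVar_sq (hη : η.IsSymm) (hdet : IsUnit η.det) :
    dirac η * (cliffVar η * cliffVar η) =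
      (2 : ℂ) • cliffVar η + cliffVar η * cliffVar η * dirac η := by
  rw [← mul_assoc, dirac_mul_cliffVar hη hdet, sub_mul, mul_assoc (cliffVar η) (dirac η),
    dirac_mul_cliffVar hη hdet, smul_mul_assoc, opH_mul_cliffVar, mul_sub, mul_smul_comm,
    ← mul_assoc]
  module

theorem dirac_mul_xHat (hη : η.IsSymm) (hdet : IsUnit η.det) (i : Fin n) :
    dirac η * xHat η i = (opH η * x η i + (1 / 2 : ℂ) • (cliffVar η * γ η i)
      + (1 / 2 : ℂ) • (cliffVar η * cliffVar η * dUp η i)) * dirac η := by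
  have h1 : dirac η * ((opH η + 1) * x η i) = opH η * x η i * dirac η + opH η * γ η i := by
    rw [← mul_assoc, dirac_mul_opH_add_one, mul_assoc, dirac_mul_x, mul_add, ← mul_assoc]
  have h2 : dirac η * (cliffVar η * γ η i) = (-2 : ℂ) • (opH η * γ η i)
      - (2 : ℂ) • (cliffVar η * dUp η i) + cliffVar η * γ η i * dirac η := by
    rw [← mul_assoc, dirac_mul_cliffVar hη hdet, sub_mul, smul_mul_assoc, mul_assoc (cliffVar η),
      dirac_mul_γ hη, mul_sub, mul_smul_comm, ← mul_assoc]
    module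
  have h3 : dirac η * (cliffVar η * cliffVar η * dUp η i) = (2 : ℂ) • (cliffVar η * dUp η i)
      + cliffVar η * cliffVar η * dUp η i * dirac η := by
    rw [← mul_assoc, dirac_mul_cliffVar_sq hη hdet, add_mul, smul_mul_assoc,
      mul_assoc (cliffVar η * cliffVar η), dirac_mul_dUp, ← mul_assoc]
  rw [xHat_eq hη hdet, mul_add, mul_add, mul_smul_comm, mul_smul_comm, h1, h2, h3, add_mul, add_mul,
    smul_mul_assoc, smul_mul_assoc]
  module

theorem xHat_mem_normalizerN (hη : η.IsSymm) (hdet : IsUnit η.det) (i : Fin n) :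
    xHat η i ∈ normalizerN η :=
  mem_normalizerN_of_dirac_mul (dirac_mul_xHat hη hdet i)

theorem xHatMon_mem_normalizerN (hη : η.IsSymm) (hdet : IsUnit η.det) (α : Fin n →₀ ℕ) :
    xHatMon η α ∈ normalizerN η := by
  refine Subalgebra.list_prod_mem _ fun a ha => ?_
  obtain ⟨i, rfl⟩ := List.mem_ofFn.mp ha
  exact pow_mem (xHat_mem_normalizerN hη hdet i) _

theorem hatOp_mem_normalizerN (hη : η.IsSymm) (hdet : IsUnit η.det) (c : Coeffs n) :
    hatOp η c ∈ normalizerN η := by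
  refine sum_mem fun w _ => (normalizerN η).smul_mem
    (mul_mem (xHatMon_mem_normalizerN hη hdet _) (Subalgebra.list_prod_mem _ fun a ha => ?_)) _
  obtain ⟨i, _, rfl⟩ := List.mem_map.mp ha
  exact gammaTilde_mem_normalizerN hη hdet i

variable (η)

/-! ### The grading of Clifford-valued polynomials by degree -/

/-- Clifford-valued polynomials that are homogeneous of degree `k` in `x`. -/
def homog (k : ℕ) : Submodule ℂ (V η) :=
  Submodule.span ℂ {v | ∃ (q : Cl η) (p : MvPolynomial (Fin n) ℂ), p.IsHomogeneous k ∧ q ⊗ₜ p = v}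

variable {η} in
theorem tmul_mem_homog {k : ℕ} (q : Cl η) {p : MvPolynomial (Fin n) ℂ} (hp : p.IsHomogeneous k) :
    q ⊗ₜ p ∈ homog η k :=
  Submodule.subset_span ⟨q, p, hp, rfl⟩

theorem weylAct_x (i : Fin n) (p : MvPolynomial (Fin n) ℂ) :
    weylAct n (Weyl.x i) p = MvPolynomial.X i * p := by
  rw [Weyl.x, weylAct_mk]; simp [freeAct]

theorem act_x_tmul (i : Fin n) (q : Cl η) (p : MvPolynomial (Fin n) ℂ) :
    act η (x η i) (q ⊗ₜ p) = q ⊗ₜ (MvPolynomial.X i * p) := by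
  rw [x, act_tmul, one_mul, weylAct_x]

theorem act_d_tmul (i : Fin n) (q : Cl η) (p : MvPolynomial (Fin n) ℂ) :
    act η (d η i) (q ⊗ₜ p) = q ⊗ₜ MvPolynomial.pderiv i p := by
  rw [d, act_tmul, one_mul, weylAct_d]

theorem act_γ_tmul (i : Fin n) (q : Cl η) (p : MvPolynomial (Fin n) ℂ) :
    act η (γ η i) (q ⊗ₜ p) = (clGamma η i * q) ⊗ₜ p := by
  rw [γ, act_tmul, map_one, Module.End.one_apply]

variable {η}

theorem act_opH_of_mem_homog {k : ℕ} {ψ : V η} (hψ : ψ ∈ homog η k) :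
    act η (opH η) ψ = (-((k : ℂ) + n / 2)) • ψ := by
  induction hψ using Submodule.span_induction with
  | mem v hv =>
    obtain ⟨q, p, hp, rfl⟩ := hv
    have h : ∑ a, act η (x η a * d η a) (q ⊗ₜ p) = (k : ℂ) • (q ⊗ₜ[ℂ] p) := by
      simp only [map_mul, Module.End.mul_apply, act_d_tmul, act_x_tmul]
      rw [← TensorProduct.tmul_sum, hp.sum_X_mul_pderiv, ← Nat.cast_smul_eq_nsmul ℂ,
        TensorProduct.tmul_smul]
    rw [opH_eq, map_sub, map_neg, map_sum, map_smul, map_one, LinearMap.sub_apply,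
      LinearMap.neg_apply, LinearMap.sum_apply, h, LinearMap.smul_apply, Module.End.one_apply]
    module
  | zero => simp
  | add u v _ _ hu hv => rw [map_add, hu, hv, smul_add]
  | smul c v _ hv => rw [map_smul, hv, smul_comm]

theorem act_cliffVar_mem_homog {k : ℕ} {ψ : V η} (hψ : ψ ∈ homog η k) :
    act η (cliffVar η) ψ ∈ homog η (k + 1) := by
  induction hψ using Submodule.span_induction with
  | mem v hv =>
    obtain ⟨q, p, hp, rfl⟩ := hv
    simp only [cliffVar, xLow, map_sum, map_mul, map_smul, LinearMap.sum_apply,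
      Module.End.mul_apply, LinearMap.smul_apply, act_x_tmul, act_γ_tmul]
    refine sum_mem fun j _ => sum_mem fun i _ => Submodule.smul_mem _ _ (tmul_mem_homog _ ?_)
    rw [add_comm]
    exact (MvPolynomial.isHomogeneous_X ℂ i).mul hp
  | zero => simp
  | add u v _ _ hu hv => rw [map_add]; exact add_mem hu hv
  | smul c v _ hv => rw [map_smul]; exact Submodule.smul_mem _ _ hv

theorem act_dirac_mem_homog {k : ℕ} {ψ : V η} (hψ : ψ ∈ homog η k) :
    act η (dirac η) ψ ∈ homog η (k - 1) := by
  induction hψ using Submodule.span_induction with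
  | mem v hv =>
    obtain ⟨q, p, hp, rfl⟩ := hv
    simp only [dirac, map_sum, map_mul, LinearMap.sum_apply, Module.End.mul_apply, act_d_tmul,
      act_γ_tmul]
    exact sum_mem fun j _ => tmul_mem_homog _ hp.pderiv
  | zero => simp
  | add u v _ _ hu hv => rw [map_add]; exact add_mem hu hv
  | smul c v _ hv => rw [map_smul]; exact Submodule.smul_mem _ _ hv

theorem act_d_of_mem_homog_zero (i : Fin n) {ψ : V η} (hψ : ψ ∈ homog η 0) :
    act η (d η i) ψ = 0 := by
  induction hψ using Submodule.span_induction with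
  | mem v hv =>
    obtain ⟨q, p, hp, rfl⟩ := hv
    rw [act_d_tmul, ((MvPolynomial.totalDegree_eq_zero_iff_eq_C).mp
      (Nat.le_zero.mp hp.totalDegree_le)), MvPolynomial.pderiv_C, TensorProduct.tmul_zero]
  | zero => simp
  | add u v _ _ hu hv => rw [map_add, hu, hv, add_zero]
  | smul c v _ hv => rw [map_smul, hv, smul_zero]

theorem act_dirac_of_mem_homog_zero {ψ : V η} (hψ : ψ ∈ homog η 0) :
    act η (dirac η) ψ = 0 := by
  simp [dirac, map_sum, act_d_of_mem_homog_zero _ hψ]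

variable (η) in
theorem iSup_homog : ⨆ k, homog η k = ⊤ := by
  rw [eq_top_iff, ← TensorProduct.span_tmul_eq_top, Submodule.span_le]
  rintro _ ⟨q, p, rfl⟩
  induction p using MvPolynomial.induction_on' with
  | monomial α c =>
    exact Submodule.mem_iSup_of_mem _
      (tmul_mem_homog q (MvPolynomial.isHomogeneous_monomial c rfl))
  | add p₁ p₂ h₁ h₂ => rw [TensorProduct.tmul_add]; exact add_mem h₁ h₂

variable (η) in
/-- The homogeneous parts are eigenspaces of `H` for distinct eigenvalues. -/
theorem iSupIndep_homog : iSupIndep (homog η) := by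
  have h : iSupIndep fun k : ℕ => (act η (opH η)).eigenspace (-((k : ℂ) + n / 2)) :=
    (act η (opH η)).eigenspaces_iSupIndep.comp fun a b hab => by simpa using hab
  exact h.mono fun k ψ hψ => Module.End.mem_eigenspace_iff.mpr (act_opH_of_mem_homog hψ)

/-! ### A nonzero multiple of the Clifford variable is not a solution of the Dirac equation -/

theorem cliffVar_mul_dirac_mul_sq_pow (hη : η.IsSymm) (hdet : IsUnit η.det) (p : ℕ) :
    cliffVar η * dirac η * cliffVar η ^ (2 * p) =
      (2 * p : ℂ) • cliffVar η ^ (2 * p) + cliffVar η ^ (2 * p + 1) * dirac η := by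
  induction p with
  | zero => simp
  | succ p ih =>
    rw [show 2 * (p + 1) = 2 * p + 2 by ring, pow_add, ← mul_assoc, ih, add_mul,
      mul_assoc _ (dirac η), pow_two, dirac_mul_cliffVar_sq hη hdet, mul_add, smul_mul_assoc,
      mul_smul_comm, ← pow_two, ← mul_assoc, ← pow_add, ← pow_add, ← pow_succ]
    rw [show 2 * p + 1 + 2 = 2 * p + 2 + 1 by ring, Nat.cast_succ]
    module

theorem cliffVar_mul_dirac_mul_odd_pow (hη : η.IsSymm) (hdet : IsUnit η.det) (p : ℕ) :
    cliffVar η * dirac η * cliffVar η ^ (2 * p + 1) =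
      (2 * p : ℂ) • cliffVar η ^ (2 * p + 1)
        + (-2 : ℂ) • (cliffVar η ^ (2 * p + 1) * opH η) - cliffVar η ^ (2 * p + 2) * dirac η := by
  rw [pow_succ, ← mul_assoc, cliffVar_mul_dirac_mul_sq_pow hη hdet, add_mul, mul_assoc _ (dirac η),
    dirac_mul_cliffVar hη hdet, mul_sub, mul_smul_comm, smul_mul_assoc, ← pow_succ, ← mul_assoc,
    ← pow_succ]
  module

/-- On the homogeneous part of degree `k`, with `Θ = ∑ γ^j x_j` and `D` the Dirac operator,
`Θ D Θ^m = c Θ^m ± Θ^{m+1} D`, where `c = m` if `m` is even and `c = 2k + n + m - 1` if `m` is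
odd. -/
theorem exists_cliffVar_dirac_cliffVar_pow (hη : η.IsSymm) (hdet : IsUnit η.det) (hn : n ≠ 0)
    {k m : ℕ} (hm : m ≠ 0) {ψ : V η} (hψ : ψ ∈ homog η k) :
    ∃ c e : ℂ, c ≠ 0 ∧ e ≠ 0 ∧
      act η (cliffVar η) (act η (dirac η) (act η (cliffVar η ^ m) ψ)) =
        c • act η (cliffVar η ^ m) ψ + e • act η (cliffVar η ^ (m + 1)) (act η (dirac η) ψ) := by
  simp only [← Module.End.mul_apply, ← map_mul]
  rw [← mul_assoc]
  obtain ⟨p, rfl | rfl⟩ := Nat.even_or_odd' m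
  · refine ⟨2 * p, 1, by exact_mod_cast hm, one_ne_zero, ?_⟩
    rw [cliffVar_mul_dirac_mul_sq_pow hη hdet, map_add, map_smul, LinearMap.add_apply, one_smul,
      LinearMap.smul_apply]
  · refine ⟨((2 * k + n + 2 * p : ℕ) : ℂ), -1, Nat.cast_ne_zero.mpr (by omega),
      neg_ne_zero.mpr one_ne_zero, ?_⟩
    rw [cliffVar_mul_dirac_mul_odd_pow hη hdet, map_sub, map_add, map_smul, map_smul,
      LinearMap.sub_apply, LinearMap.add_apply, LinearMap.smul_apply, LinearMap.smul_apply,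
      map_mul (act η) _ (opH η), Module.End.mul_apply, act_opH_of_mem_homog hψ, map_smul]
    push_cast
    module

/-- Induction on the degree `k` of `ψ`: if `D Θ^m ψ = 0`, then `Θ^m ψ` is a scalar multiple of
`Θ^{m+1} D ψ`, which also solves the Dirac equation, while `D ψ` has degree `k - 1`. -/
theorem cliffVar_pow_eq_zero_of_dirac (hη : η.IsSymm) (hdet : IsUnit η.det) {k m : ℕ} (hm : m ≠ 0)
    {ψ : V η} (hψ : ψ ∈ homog η k)
    (h : act η (dirac η) (act η (cliffVar η ^ m) ψ) = 0) : act η (cliffVar η ^ m) ψ = 0 := by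
  rcases eq_or_ne n 0 with rfl | hn
  -- for `n = 0` the scalar `c` may vanish, but then `Θ` is an empty sum
  · simp [cliffVar, hm]
  induction k generalizing m ψ with
  | zero =>
    obtain ⟨c, e, hc, -, hce⟩ := exists_cliffVar_dirac_cliffVar_pow hη hdet hn hm hψ
    rw [h, act_dirac_of_mem_homog_zero hψ, map_zero, map_zero, smul_zero, add_zero] at hce
    exact (smul_eq_zero.mp hce.symm).resolve_left hc
  | succ k ih =>
    obtain ⟨c, e, hc, he, hce⟩ := exists_cliffVar_dirac_cliffVar_pow hη hdet hn hm hψ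
    rw [h, map_zero] at hce
    have h' : act η (cliffVar η ^ (m + 1)) (act η (dirac η) ψ) = 0 := by
      have hD : act η (dirac η) ψ ∈ homog η k := by
        have hD' := act_dirac_mem_homog hψ
        rwa [Nat.add_sub_cancel] at hD'
      refine ih m.succ_ne_zero hD ?_
      have := congrArg (act η (dirac η)) hce
      rw [map_zero, map_add, map_smul, map_smul, h, smul_zero, zero_add] at this
      exact (smul_eq_zero.mp this.symm).resolve_left he
    rw [h', smul_zero, add_zero] at hce
    exact (smul_eq_zero.mp hce.symm).resolve_left hc

variable (η) in
/-- The image of the Clifford variable `∑ γ^j x_j` in the Clifford-valued polynomials. -/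
def cliffRange : Submodule ℂ (V η) := LinearMap.range (act η (cliffVar η))

/-- The sum in the Fischer decomposition `V = V⁺ ⊕ (∑ γ^j x_j) V` is direct. -/
theorem disjoint_Vplus_cliffRange (hη : η.IsSymm) (hdet : IsUnit η.det) :
    Disjoint (Vplus η) (cliffRange η) := by
  rw [Submodule.disjoint_def]
  rintro _ hφ ⟨ψ, rfl⟩
  have hφ' : act η (dirac η) (act η (cliffVar η) ψ) = 0 := LinearMap.mem_ker.mp hφ
  have hψ : ψ ∈ ⨆ k, homog η k := by rw [iSup_homog]; trivial
  obtain ⟨f, hf, rfl⟩ := (Submodule.mem_iSup_iff_exists_finsupp _ _).mp hψ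
  clear hφ hψ
  rw [Finsupp.sum] at hφ' ⊢
  rw [map_sum, map_sum] at hφ'
  have h := (iSupIndep_iff_finsetSum_eq_zero_imp_eq_zero _).mp (iSupIndep_homog η) f.support
    (fun k => act η (dirac η) (act η (cliffVar η) (f k)))
    (fun k _ => by
      have hk := act_dirac_mem_homog (act_cliffVar_mem_homog (hf k))
      rwa [Nat.add_sub_cancel] at hk) hφ'
  rw [map_sum]
  refine Finset.sum_eq_zero fun k hk => ?_
  have hk' := cliffVar_pow_eq_zero_of_dirac hη hdet one_ne_zero (hf k)
  rw [pow_one] at hk'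
  exact hk' (h k hk)

/-! ### The action of the raising operators modulo multiples of the Clifford variable -/

theorem act_mem_cliffRange_of_mul {a b : WC η} (h : a * cliffVar η = cliffVar η * b) {u : V η}
    (hu : u ∈ cliffRange η) : act η a u ∈ cliffRange η := by
  obtain ⟨v, rfl⟩ := hu
  exact ⟨act η b v, by simp only [← Module.End.mul_apply, ← map_mul, h]⟩

theorem act_cliffVar_mul_mem_cliffRange (a : WC η) (ψ : V η) :
    act η (cliffVar η * a) ψ ∈ cliffRange η :=
  ⟨act η a ψ, by rw [map_mul, Module.End.mul_apply]⟩

/-- The leading term `(H + 1) x^i` of the raising operator preserves the multiples of `Θ`, since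
`x^i` commutes with `Θ` and `(H + 1) Θ = Θ H`. -/
theorem act_opH_add_one_mul_x_mem_cliffRange (i : Fin n) {u : V η} (hu : u ∈ cliffRange η) :
    act η ((opH η + 1) * x η i) u ∈ cliffRange η := by
  refine act_mem_cliffRange_of_mul (b := opH η * x η i) ?_ hu
  rw [mul_assoc, ← cliffVar_mul_x, ← mul_assoc, add_mul, opH_mul_cliffVar, one_mul, sub_add_cancel,
    mul_assoc]

/-- Since `∑ x^j x_j = Θ²`, the correction terms of the raising operator are left multiples of
`Θ`. -/
theorem act_xHat_sub_mem_cliffRange (hη : η.IsSymm) (hdet : IsUnit η.det) (i : Fin n) (ψ : V η) :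
    act η (xHat η i) ψ - act η ((opH η + 1) * x η i) ψ ∈ cliffRange η := by
  rw [xHat_eq hη hdet, map_add, map_add, LinearMap.add_apply, LinearMap.add_apply, add_assoc,
    add_sub_cancel_left, map_smul, map_smul, mul_assoc]
  exact add_mem (Submodule.smul_mem _ _ (act_cliffVar_mul_mem_cliffRange _ _))
    (Submodule.smul_mem _ _ (act_cliffVar_mul_mem_cliffRange _ _))

theorem normConst_succ (n k : ℕ) : normConst n (k + 1) = -((k : ℂ) + n / 2) * normConst n k := by
  have h : ∀ m : ℕ, ∏ k ∈ Finset.Icc 1 m, ((n : ℂ) / 2 + (m : ℂ) - (k : ℂ)) =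
      ∏ j ∈ Finset.range m, ((n : ℂ) / 2 + j) := fun m => by
    rw [← Finset.prod_range_reflect, Finset.range_eq_Ico, Finset.prod_Ico_eq_prod_range,
      ← Finset.Ico_add_one_right_eq_Icc, Finset.prod_Ico_eq_prod_range]
    refine Finset.prod_congr rfl fun j hj => ?_
    have hj : j < m := by simpa using hj
    rw [Nat.zero_add, Nat.sub_sub, Nat.cast_sub (by omega)]
    push_cast
    ring
  rw [normConst, normConst, h, h, Finset.prod_range_succ]
  ring

theorem normConst_ne_zero {n k : ℕ} (hn : n = 0 → k = 0) : normConst n k ≠ 0 := by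
  induction k with
  | zero => simp [normConst]
  | succ k ih =>
    rw [normConst_succ]
    have hn0 : n ≠ 0 := fun h => by simpa using hn h
    refine mul_ne_zero (neg_ne_zero.mpr ?_) (ih fun h => absurd h hn0)
    have : ((2 * k + n : ℕ) : ℂ) ≠ 0 := Nat.cast_ne_zero.mpr (by omega)
    intro h
    apply this
    push_cast
    linear_combination 2 * h

theorem isHomogeneous_prod_X (l : List (Fin n)) :
    ((l.map MvPolynomial.X).prod : MvPolynomial (Fin n) ℂ).IsHomogeneous l.length := by
  induction l with
  | nil => exact MvPolynomial.isHomogeneous_one _ _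
  | cons i l ih =>
    rw [List.map_cons, List.prod_cons, List.length_cons, add_comm]
    exact (MvPolynomial.isHomogeneous_X ℂ i).mul ih

/-- A word in the raising operators acts on constants, up to a multiple of the Clifford variable and
a normalizing scalar, as multiplication by the corresponding monomial. -/
theorem act_prod_xHat_sub_mem_cliffRange (hη : η.IsSymm) (hdet : IsUnit η.det) (l : List (Fin n))
    (q : Cl η) :
    act η (l.map (xHat η)).prod (q ⊗ₜ 1) -
      normConst n l.length • (q ⊗ₜ[ℂ] (l.map MvPolynomial.X).prod) ∈ cliffRange η := by
  induction l with
  | nil => simp [normConst]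
  | cons i l ih =>
    simp only [List.map_cons, List.prod_cons, List.length_cons, map_mul (act η) (xHat η i),
      Module.End.mul_apply]
    set θ := act η (l.map (xHat η)).prod (q ⊗ₜ 1)
    set P : MvPolynomial (Fin n) ℂ := (l.map MvPolynomial.X).prod
    have h1 := act_xHat_sub_mem_cliffRange hη hdet i θ
    have h2 := act_opH_add_one_mul_x_mem_cliffRange i ih
    have h3 : act η ((opH η + 1) * x η i) (normConst n l.length • (q ⊗ₜ P)) =
        normConst n (l.length + 1) • (q ⊗ₜ (MvPolynomial.X i * P)) := by
      have hP : q ⊗ₜ[ℂ] (MvPolynomial.X i * P) ∈ homog η (l.length + 1) := by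
        rw [add_comm]
        exact tmul_mem_homog q ((MvPolynomial.isHomogeneous_X ℂ i).mul (isHomogeneous_prod_X l))
      rw [map_smul, map_mul, Module.End.mul_apply, act_x_tmul, map_add, map_one,
        LinearMap.add_apply, act_opH_of_mem_homog hP, Module.End.one_apply, normConst_succ]
      push_cast
      module
    rw [map_sub, h3] at h2
    simpa using add_mem h1 h2

/-- The word with `α i` letters `i`, in order of increasing index. -/
def expWord (α : Fin n →₀ ℕ) : List (Fin n) :=
  (List.ofFn fun i => List.replicate (α i) i).flatten

theorem prod_map_expWord {M : Type*} [Monoid M] (f : Fin n → M) (α : Fin n →₀ ℕ) :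
    ((expWord α).map f).prod = (List.ofFn fun i => f i ^ α i).prod := by
  simp [expWord, List.map_flatten, List.prod_flatten, List.map_ofFn, Function.comp_def]

theorem length_expWord (α : Fin n →₀ ℕ) : (expWord α).length = α.degree := by
  simp [expWord, List.length_flatten, List.map_ofFn, Function.comp_def, List.sum_ofFn,
    Finsupp.degree_eq_sum]

theorem prod_X_expWord (α : Fin n →₀ ℕ) :
    ((expWord α).map MvPolynomial.X).prod = MvPolynomial.monomial α (1 : ℂ) := by
  rw [prod_map_expWord, List.prod_ofFn, MvPolynomial.monomial_eq, MvPolynomial.C_1, one_mul,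
    Finsupp.prod_fintype _ _ fun i => pow_zero _]

theorem act_gammaTilde_tmul_one (hn : n ≠ 2) (i : Fin n) (q : Cl η) :
    act η (gammaTilde η i) (q ⊗ₜ 1) = (clGamma η i * q) ⊗ₜ 1 := by
  have h0 : ∀ q : Cl η, q ⊗ₜ[ℂ] (1 : MvPolynomial (Fin n) ℂ) ∈ homog η 0 := fun q =>
    tmul_mem_homog q (MvPolynomial.isHomogeneous_one _ _)
  have hd : act η (dUp η i) (q ⊗ₜ 1) = 0 := by
    simp [dUp, map_sum, act_d_of_mem_homog_zero _ (h0 q)]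
  have hn' : (1 - (n : ℂ) / 2) ≠ 0 := by
    intro h
    apply hn
    have : (n : ℂ) = (2 : ℕ) := by
      push_cast
      linear_combination -2 * h
    exact_mod_cast this
  rw [gammaTilde, gammaHat_eq, map_smul, LinearMap.smul_apply, map_add, LinearMap.add_apply,
    map_mul, map_mul, Module.End.mul_apply, Module.End.mul_apply, hd, map_zero, add_zero,
    act_γ_tmul, map_add, map_one, LinearMap.add_apply, act_opH_of_mem_homog (h0 _),
    Module.End.one_apply, inv_smul_eq_iff₀ hn']
  push_cast
  module

theorem act_prod_gammaTilde_one (hn : n ≠ 2) (β : List (Fin n)) :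
    act η (β.map (gammaTilde η)).prod (1 ⊗ₜ 1) = (β.map (clGamma η)).prod ⊗ₜ 1 := by
  induction β with
  | nil => simp
  | cons i β ih =>
    rw [List.map_cons, List.prod_cons, map_mul, Module.End.mul_apply, ih,
      act_gammaTilde_tmul_one hn, List.map_cons, List.prod_cons]

theorem act_hatOp_sub_expand_mem_cliffRange (hn : n ≠ 2) (hη : η.IsSymm) (hdet : IsUnit η.det)
    (c : Coeffs n) : act η (hatOp η c) (1 ⊗ₜ 1) - expand η c ∈ cliffRange η := by
  rw [hatOp, expand, Finsupp.sum, Finsupp.sum, map_sum, LinearMap.sum_apply,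
    ← Finset.sum_sub_distrib]
  refine sum_mem fun w _ => ?_
  -- for `n = 0` the only exponent is the empty one
  have hc : normConst n w.1.degree ≠ 0 := normConst_ne_zero fun h => by
    subst h
    simp [Finsupp.degree_eq_sum]
  have h := act_prod_xHat_sub_mem_cliffRange hη hdet (expWord w.1) (w.2.map (clGamma η)).prod
  rw [prod_map_expWord, length_expWord, prod_X_expWord] at h
  have h' := (cliffRange η).smul_mem (c w / normConst n w.1.degree) h
  rwa [smul_sub, smul_smul, div_mul_cancel₀ _ hc, ← act_prod_gammaTilde_one hn,
    ← Module.End.mul_apply, ← map_mul, ← LinearMap.smul_apply, ← map_smul] at h'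

/-- For a solution, the two sides are congruent modulo multiples of `Θ` and both solve the Dirac
equation, so they agree. -/
theorem act_hatOp_one (hn : n ≠ 2) (hη : η.IsSymm) (hdet : IsUnit η.det) (c : Coeffs n)
    (hc : expand η c ∈ Vplus η) : act η (hatOp η c) (1 ⊗ₜ 1) = expand η c :=
  sub_eq_zero.mp <| Submodule.disjoint_def.mp (disjoint_Vplus_cliffRange hη hdet) _
    (sub_mem (normalizerN_act η ⟨_, hatOp_mem_normalizerN hη hdet c⟩ (oneSol η).2) hc)
    (act_hatOp_sub_expand_mem_cliffRange hn hη hdet c)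

/-! ### Expansions in strictly increasing words -/

variable (η) in
/-- The span of the Clifford monomials of strictly increasing words with letters in `S`. -/
def wordSpan (S : Set (Fin n)) : Submodule ℂ (Cl η) :=
  Submodule.span ℂ ((fun β : List (Fin n) => (β.map (clGamma η)).prod) ''
    {β | β.Pairwise (· < ·) ∧ ∀ b ∈ β, b ∈ S})

theorem prod_mem_wordSpan {S : Set (Fin n)} {β : List (Fin n)} (hβ : β.Pairwise (· < ·))
    (hS : ∀ b ∈ β, b ∈ S) : (β.map (clGamma η)).prod ∈ wordSpan η S :=
  Submodule.subset_span ⟨β, ⟨hβ, hS⟩, rfl⟩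

theorem clGamma_mul_mem_wordSpan_of_lt {S : Set (Fin n)} {b : Fin n} (hb : b ∈ S) {q : Cl η}
    (hq : q ∈ wordSpan η {c | b < c ∧ c ∈ S}) : clGamma η b * q ∈ wordSpan η S := by
  induction hq using Submodule.span_induction with
  | mem v hv =>
    obtain ⟨β, ⟨hβ, hS⟩, rfl⟩ := hv
    have := prod_mem_wordSpan (η := η) (S := S) (β := b :: β)
      (List.pairwise_cons.mpr ⟨fun c hc => (hS c hc).1, hβ⟩)
      (List.forall_mem_cons.mpr ⟨hb, fun c hc => (hS c hc).2⟩)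
    simpa using this
  | zero => simp
  | add u v _ _ hu hv => rw [mul_add]; exact add_mem hu hv
  | smul c v _ hv => rw [mul_smul_comm]; exact Submodule.smul_mem _ _ hv

/-- Straightening: a letter multiplied on the left moves to its place in an increasing word. -/
theorem clGamma_mul_prod_mem_wordSpan {S : Set (Fin n)} {i : Fin n} (hi : i ∈ S)
    {β : List (Fin n)} (hβ : β.Pairwise (· < ·)) (hS : ∀ b ∈ β, b ∈ S) :
    clGamma η i * (β.map (clGamma η)).prod ∈ wordSpan η S := by
  induction β generalizing S with
  | nil => simpa using prod_mem_wordSpan (η := η) (S := S) (List.pairwise_singleton _ i) (by simpa)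
  | cons b β ih =>
    obtain ⟨hb, hβ'⟩ := List.pairwise_cons.mp hβ
    obtain ⟨hbS, hβS⟩ := List.forall_mem_cons.mp hS
    have hmem := prod_mem_wordSpan (η := η) hβ' hβS
    have hanti := clGamma_anticomm η i b
    rw [Algebra.algebraMap_eq_smul_one] at hanti
    rcases lt_trichotomy i b with h | rfl | h
    · refine clGamma_mul_mem_wordSpan_of_lt hi (prod_mem_wordSpan hβ fun c hc => ⟨?_, hS c hc⟩)
      rcases List.mem_cons.mp hc with rfl | hc
      exacts [h, h.trans (hb c hc)]
    · have hsq : clGamma η i * clGamma η i = η i i • 1 := by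
        refine smul_right_injective _ (two_ne_zero' ℂ) ?_
        simp only [two_smul, hanti, ← add_smul]
      rw [List.map_cons, List.prod_cons, ← mul_assoc, hsq, smul_mul_assoc, one_mul]
      exact Submodule.smul_mem _ _ hmem
    · rw [List.map_cons, List.prod_cons, ← mul_assoc, eq_sub_of_add_eq hanti, sub_mul,
        smul_mul_assoc, one_mul, mul_assoc]
      exact sub_mem (Submodule.smul_mem _ _ hmem) (clGamma_mul_mem_wordSpan_of_lt hbS
        (ih ⟨h, hi⟩ hβ' fun c hc => ⟨hb c hc, hβS c hc⟩))

variable (η) in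
theorem wordSpan_univ : wordSpan η Set.univ = ⊤ := by
  rw [eq_top_iff]
  rintro q -
  induction q using CliffordAlgebra.left_induction with
  | algebraMap r =>
    rw [Algebra.algebraMap_eq_smul_one]
    refine Submodule.smul_mem _ _ ?_
    simpa using prod_mem_wordSpan (η := η) (S := Set.univ) (β := []) (by simp) (by simp)
  | add q₁ q₂ h₁ h₂ => exact add_mem h₁ h₂
  | ι_mul q v hq =>
    have hv : CliffordAlgebra.ι (Matrix.toQuadraticForm' η) v = ∑ i, v i • clGamma η i := by
      conv_lhs => rw [pi_eq_sum_univ' v]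
      simp only [map_sum, map_smul, clGamma]
    rw [hv, Finset.sum_mul]
    refine sum_mem fun i _ => ?_
    rw [smul_mul_assoc]
    refine Submodule.smul_mem _ _ ?_
    clear hv
    induction hq using Submodule.span_induction with
    | mem q hq =>
      obtain ⟨β, ⟨hβ, -⟩, rfl⟩ := hq
      exact clGamma_mul_prod_mem_wordSpan (Set.mem_univ i) hβ fun _ _ => Set.mem_univ _
    | zero => simp
    | add u v _ _ hu hv => rw [mul_add]; exact add_mem hu hv
    | smul c v _ hv => rw [mul_smul_comm]; exact Submodule.smul_mem _ _ hv

theorem exists_expand_eq (φ : V η) :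
    ∃ c : Coeffs n, (∀ w ∈ c.support, w.2.Pairwise (· < ·)) ∧ expand η c = φ := by
  let b : (Fin n →₀ ℕ) × List (Fin n) → V η := fun w =>
    (w.2.map (clGamma η)).prod ⊗ₜ MvPolynomial.monomial w.1 1
  have hspan : φ ∈ Submodule.span ℂ (b '' {w | w.2.Pairwise (· < ·)}) := by
    induction φ using TensorProduct.induction_on with
    | zero => exact zero_mem _
    | add φ ψ hφ hψ => exact add_mem hφ hψ
    | tmul q p =>
      have hq : q ∈ wordSpan η Set.univ := by rw [wordSpan_univ]; trivial
      induction hq using Submodule.span_induction with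
      | zero => rw [TensorProduct.zero_tmul]; exact zero_mem _
      | add u v _ _ hu hv => rw [TensorProduct.add_tmul]; exact add_mem hu hv
      | smul c v _ hv => rw [← TensorProduct.smul_tmul']; exact Submodule.smul_mem _ _ hv
      | mem q hq =>
        obtain ⟨β, ⟨hβ, -⟩, rfl⟩ := hq
        induction p using MvPolynomial.induction_on' with
        | add p₁ p₂ h₁ h₂ => rw [TensorProduct.tmul_add]; exact add_mem h₁ h₂
        | monomial α c =>
          have hm : MvPolynomial.monomial α c = c • MvPolynomial.monomial α (1 : ℂ) := by
            rw [MvPolynomial.smul_monomial, smul_eq_mul, mul_one]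
          rw [hm, TensorProduct.tmul_smul]
          exact Submodule.smul_mem _ _ (Submodule.subset_span ⟨(α, β), hβ, rfl⟩)
  obtain ⟨c, hc, rfl⟩ := (Finsupp.mem_span_image_iff_linearCombination ℂ).mp hspan
  exact ⟨c, fun w hw => hc hw, rfl⟩

end DiracReduction
end

theorem mainTheorem4 (n : ℕ) (hn : n ≠ 2) (η : Matrix (Fin n) (Fin n) ℂ) (hη : η.IsSymm)
    (hdet : IsUnit η.det) :
    (∀ i, DiracReduction.xHat η i ∈ DiracReduction.normalizerN η) ∧
    (∀ i, DiracReduction.gammaTilde η i ∈ DiracReduction.normalizerN η) ∧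
    (∀ φ : DiracReduction.Vplus η,
      (∃ c : DiracReduction.Coeffs n, (∀ w ∈ c.support, w.2.Pairwise (· < ·)) ∧
        DiracReduction.expand η c = φ) ∧
      ∀ c : DiracReduction.Coeffs n, DiracReduction.expand η c = φ →
        ∃ h : DiracReduction.hatOp η c ∈ DiracReduction.normalizerN η,
          DiracReduction.actZ η (DiracReduction.toZ η (DiracReduction.hatOp η c) h)
            (DiracReduction.oneSol η) = φ) ∧
    (∀ φ : DiracReduction.Vplus η, ∃ z : DiracReduction.Z η,
      DiracReduction.actZ η z (DiracReduction.oneSol η) = φ) := by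
  have hact : ∀ (φ : DiracReduction.Vplus η) (c : DiracReduction.Coeffs n),
      DiracReduction.expand η c = φ →
        ∃ h : DiracReduction.hatOp η c ∈ DiracReduction.normalizerN η,
          DiracReduction.actZ η (DiracReduction.toZ η (DiracReduction.hatOp η c) h)
            (DiracReduction.oneSol η) = φ := fun φ c hc =>
    ⟨DiracReduction.hatOp_mem_normalizerN hη hdet c, Subtype.ext <|
      (DiracReduction.act_hatOp_one hn hη hdet c (hc ▸ φ.2)).trans hc⟩
  refine ⟨DiracReduction.xHat_mem_normalizerN hη hdet,
    DiracReduction.gammaTilde_mem_normalizerN hη hdet,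
    fun φ => ⟨DiracReduction.exists_expand_eq _, hact φ⟩, fun φ => ?_⟩
  obtain ⟨c, -, hc⟩ := DiracReduction.exists_expand_eq (φ : DiracReduction.V η)
  obtain ⟨h, hz⟩ := hact φ c hc
  exact ⟨_, hz⟩
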